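/- An algebra is a nonempty set with finitely many finitary operations. For a finite algebra $\mathbb A$ and $n\ge 1$ let $\mathscr V(\mathbb A)^{(n)}$ denote the class of all algebras, in the signature of $\mathbb A$, that satisfy every identity in at most $n$ variables that is valid in $\mathbb A$. An algebra is $d$-generated if it is generated by some set of at most $d$ of its elements. The algebra $\mathbb A$ is inherently nonfinitely based in the finite sense if for every $n\ge 1$ there exists $d\ge 1$ such that $\mathscr V(\mathbb A)^{(n)}$ contains arbitrarily large finite $d$-generated algebras; that is, for every $\ell\in\mathbb N$ it contains a finite $d$-generated algebra with at least $\ell$ elements. Theorem. Let $\alpha$ be a faithful left action $(g,s)\mapsto gs$ of a finite non-nilpotent group $G$ on a finite set $S$. Let $\mathbb A(G,S,\alpha)^\ast$ be the algebra with universe $G\times S$ and two basic operations: the unary operation $f((g,s))=(g,gs)$ and the binary operation $d((g_1,s_1),(g_2,s_2))=(g_1,s_2)$. Then $\mathbb A(G,S,\alpha)^\ast$ is inherently nonfinitely based in the finite sense. -/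

import Mathlib

universe u v w

namespace GroupActionAlgebra

/-! ### Varieties and inherent nonfinite basis in the finite sense

An algebra is a structure for a first-order language without relation symbols, and an identity
in the variables `x₀, …, x_{n-1}` is a pair of terms over `Fin n`. -/

section General

variable (L : FirstOrder.Language.{0, 0}) [L.IsAlgebraic]

/-- The algebra `A` satisfies the `n`-variable identity `s ≈ t`. -/
def Satisfies (A : Type w) [L.Structure A] {n : ℕ} (s t : L.Term (Fin n)) : Prop :=
  ∀ x : Fin n → A, s.realize x = t.realize x

/-- `B` belongs to `𝒱(A)⁽ⁿ⁾`, the class of all models of the `n`-variable identities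
valid in `A`. -/
def MemVarietyN (A : Type w) [L.Structure A] (n : ℕ) (B : Type v) [L.Structure B] : Prop :=
  ∀ s t : L.Term (Fin n), Satisfies L A s t → Satisfies L B s t

/-- `B` is `d`-generated: it is generated by some set of at most `d` elements. -/
def IsNGenerated (d : ℕ) (B : Type v) [L.Structure B] : Prop :=
  ∃ X : Finset B, X.card ≤ d ∧ FirstOrder.Language.Substructure.closure L (X : Set B) = ⊤

/-- The finite algebra `A` is inherently nonfinitely based in the finite sense: for every `n ≥ 1`
there is `d ≥ 1` such that `𝒱(A)⁽ⁿ⁾` contains arbitrarily large finite `d`-generated algebras.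
(Every finite algebra is isomorphic to one whose universe is in `Type`, so quantifying
over `Type` loses nothing.) -/
def IsINFBFin (A : Type w) [L.Structure A] [Finite A] : Prop :=
  ∀ n : ℕ, 1 ≤ n → ∃ d : ℕ, 1 ≤ d ∧ ∀ ℓ : ℕ, ∃ (B : Type) (_ : L.Structure B),
    Finite B ∧ ℓ ≤ Nat.card B ∧ IsNGenerated L d B ∧ MemVarietyN L A n B

end General

/-! ### The algebra of a group action -/

/-- The operation symbols: `f` is unary, `d` is binary. -/
inductive OpSymbol : ℕ → Type
  | f : OpSymbol 1
  | d : OpSymbol 2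

/-- The signature with a unary operation `f` and a binary operation `d`. -/
def signature : FirstOrder.Language.{0, 0} where
  Functions := OpSymbol
  Relations := fun _ => Empty

instance : signature.IsAlgebraic := fun _ => inferInstanceAs (IsEmpty Empty)

/-- The universe `G × S` of the algebra `𝔸(G, S, α)*`. -/
def Alg (G : Type u) (S : Type v) : Type (max u v) := G × S

instance (G : Type u) (S : Type v) [Finite G] [Finite S] : Finite (Alg G S) :=
  inferInstanceAs (Finite (G × S))

/-- The operations of `𝔸(G, S, α)*`, where `α` is the given action of `G` on `S`:
`f (g, s) = (g, g • s)` and `d ((g₁, s₁), (g₂, s₂)) = (g₁, s₂)`. -/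
instance algStructure (G : Type u) (S : Type v) [Group G] [MulAction G S] :
    signature.Structure (Alg G S) where
  funMap {_} op := match op with
    | OpSymbol.f => fun x => ((x 0).1, (x 0).1 • (x 0).2)
    | OpSymbol.d => fun x => ((x 0).1, (x 1).2)
  RelMap := fun r => Empty.elim r

end GroupActionAlgebra

/-! As an operation of `Alg G S`, a term is given by its left variable, its right variable and a
positive word acting on the latter. So an identity says that the outer variables agree and that the
two words are equal as laws of `G` (`termData_of_satisfies`).

Non-nilpotency makes these laws rigid. A smallest non-nilpotent group inheriting them has an abelian
normal subgroup `N` of exponent `q` and an element `c` acting on `N` with prime order `p ≠ q`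
(`exists_section_coprime_action`). Sending letters into `N` or to powers of `c` and applying Fourier
inversion shows that the words of a law agree in `wordShift` mod `p` and in every `countAt` mod `q`,
even after identifying letters.

The large algebras let `n + 1` letters act on `Z × (Fin n → ZMod p)` by `towerAct`. Among `n`
variables some letter is missing. Without `none`, `Z` is never moved; without `some k`, coordinate
`k` is frozen, so no path visits both translations `0` and `1`, and `Z` is moved by powers of `x`
only or of `y` only, with exponents counted mod `q`. Hence the `n`-variable identities survive. All
letters together act transitively, however large `Z` is. -/

/-! ### Minimal non-nilpotent groups. -/

theorem Subgroup.lt_normalizer_inf_of_lt {G : Type*} [Group G] {I M : Subgroup G}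
    [Group.IsNilpotent M] (h : I < M) : I < Subgroup.normalizer (I : Set G) ⊓ M := by
  have h1 : I.subgroupOf M < ⊤ := by
    rw [lt_top_iff_ne_top, Ne, Subgroup.subgroupOf_eq_top]
    exact not_le_of_gt h
  have h2 := Group.normalizerCondition_of_isNilpotent (G := M) _ h1
  obtain ⟨x, hx, hxI⟩ := SetLike.exists_of_lt h2
  refine lt_of_le_of_ne (le_inf Subgroup.le_normalizer h.le) fun he => ?_
  suffices hxn : (x : G) ∈ Subgroup.normalizer (I : Set G) ⊓ M from hxI (show (x : G) ∈ I from he ▸ hxn)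
  refine Subgroup.mem_inf.2 ⟨?_, x.2⟩
  rw [Subgroup.mem_normalizer_iff]
  rw [Subgroup.mem_normalizer_iff] at hx
  intro y
  constructor
  · intro hy
    exact (hx ⟨y, h.le hy⟩).1 hy
  · intro hy
    have hyM : y ∈ M := by
      have := M.mul_mem (M.mul_mem (M.inv_mem x.2) (h.le hy)) x.2
      simpa [mul_assoc] using this
    exact (hx ⟨y, hyM⟩).2 hy

theorem IsCoatom.map_conj {G : Type*} [Group G] {M : Subgroup G} (hM : IsCoatom M) (g : G) :
    IsCoatom (M.map (MulAut.conj g).toMonoidHom) :=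
  (OrderIso.isCoatom_iff (MulEquiv.mapSubgroup (MulAut.conj g)) M).2 hM

section MinimalNonnilpotent

variable {G : Type*} [Group G] [Finite G]

/-- Take a largest nontrivial intersection `I`. Its normalizer is proper by simplicity, so it lies
in some maximal `M₃`. Normalizers grow in the nilpotent groups `M₁` and `M₂`, so `M₃` meets each in
more than `I` and must equal both. -/
theorem coatom_inf_eq_bot_of_simple [IsSimpleGroup G]
    (hmin : ∀ M : Subgroup G, M ≠ ⊤ → Group.IsNilpotent M) :
    ∀ M₁ M₂ : Subgroup G, IsCoatom M₁ → IsCoatom M₂ → M₁ ≠ M₂ → M₁ ⊓ M₂ = ⊥ := by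
  suffices H : ∀ I M₁ M₂ : Subgroup G, IsCoatom M₁ → IsCoatom M₂ → M₁ ≠ M₂ →
      M₁ ⊓ M₂ = I → I = ⊥ from fun M₁ M₂ h₁ h₂ h => H _ M₁ M₂ h₁ h₂ h rfl
  intro I
  induction I using WellFoundedGT.induction with
  | ind I ih =>
  intro M₁ M₂ h₁ h₂ hne hI
  by_contra hbot
  have hlt : ∀ M M' : Subgroup G, IsCoatom M → IsCoatom M' → M ≠ M' → M ⊓ M' < M := by
    intro M M' hM hM' h
    refine lt_of_le_of_ne inf_le_left fun he => h ?_
    exact (hM.le_iff.1 (inf_eq_left.1 he)).resolve_left hM'.1 |>.symm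
  have hI₁ : I < M₁ := hI ▸ hlt M₁ M₂ h₁ h₂ hne
  have hI₂ : I < M₂ := by
    rw [← hI, inf_comm]
    exact hlt M₂ M₁ h₂ h₁ hne.symm
  have hnorm : Subgroup.normalizer (I : Set G) ≠ ⊤ := by
    intro h
    have hn : I.Normal := Subgroup.normalizer_eq_top_iff.1 h
    rcases hn.eq_bot_or_eq_top with h | h
    · exact hbot h
    · exact h₁.1 (top_le_iff.1 (h ▸ hI₁.le))
  obtain ⟨M₃, h₃, hle⟩ := (eq_top_or_exists_le_coatom _).resolve_left hnorm
  have key : ∀ M : Subgroup G, IsCoatom M → I < M → M₃ = M := by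
    intro M hM hIM
    by_contra hne
    have := hmin M hM.1
    have hgt : I < M₃ ⊓ M :=
      (Subgroup.lt_normalizer_inf_of_lt hIM).trans_le (inf_le_inf_right _ hle)
    exact (bot_le.trans_lt hgt).ne' (ih _ hgt M₃ M h₃ hM hne rfl)
  exact hne ((key M₁ h₁ hI₁).symm.trans (key M₂ h₂ hI₂))

/-- The conjugates of the nonidentity elements of `M` by coset representatives. -/
noncomputable def cosetConj (M : Subgroup G) (x : (G ⧸ M) × {m : M // m ≠ 1}) : {g : G // g ≠ 1} :=
  ⟨x.1.out * x.2.1 * x.1.out⁻¹, by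
    have := x.2.2
    rw [Ne, conj_eq_one_iff]
    simpa using this⟩

/-- Maximal subgroups are self-normalizing and meet trivially, so the conjugates of one cover at
least half of `|G|` nonidentity elements, but not all of them. A maximal subgroup through a missed
element gives a disjoint family of the same kind, which is too many elements. -/
theorem isNilpotent_of_simple [IsSimpleGroup G]
    (hmin : ∀ M : Subgroup G, M ≠ ⊤ → Group.IsNilpotent M) : Group.IsNilpotent G := by
  by_contra hG
  have hinf := coatom_inf_eq_bot_of_simple hmin
  have hcyc : ∀ g : G, Subgroup.zpowers g ≠ ⊤ := by
    intro g hg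
    have : IsCyclic G := ⟨g, fun x => (hg ▸ Subgroup.mem_top x : x ∈ Subgroup.zpowers g)⟩
    let : CommGroup G := IsCyclic.commGroup
    exact hG inferInstance
  have hmem : ∀ g : G, ∃ M : Subgroup G, IsCoatom M ∧ g ∈ M := by
    intro g
    obtain ⟨M, hM, hle⟩ := (eq_top_or_exists_le_coatom _).resolve_left (hcyc g)
    exact ⟨M, hM, hle (Subgroup.mem_zpowers g)⟩
  have hbot : ∀ M : Subgroup G, IsCoatom M → M ≠ ⊥ := by
    rintro M hM rfl
    obtain ⟨g, hg⟩ := exists_ne (1 : G)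
    rcases hM.le_iff.1 (bot_le : ⊥ ≤ Subgroup.zpowers g) with h | h
    · exact hcyc g h
    · exact hg (Subgroup.zpowers_eq_bot.1 h)
  have hnorm : ∀ M : Subgroup G, IsCoatom M → Subgroup.normalizer (M : Set G) = M := by
    intro M hM
    refine (hM.le_iff.1 Subgroup.le_normalizer).resolve_left fun h => ?_
    rcases (Subgroup.normalizer_eq_top_iff.1 h).eq_bot_or_eq_top with h | h
    · exact hbot M hM h
    · exact hM.1 h
  have hconj : ∀ (M M' : Subgroup G), IsCoatom M → IsCoatom M' → ∀ g g' : G, ∀ m ∈ M, ∀ m' ∈ M',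
      m ≠ 1 → g * m * g⁻¹ = g' * m' * g'⁻¹ →
      ∀ z, z ∈ M ↔ g'⁻¹ * g * z * (g'⁻¹ * g)⁻¹ ∈ M' := by
    intro M M' hM hM' g g' m hm m' hm' hm1 he
    suffices hmap : M.map (MulAut.conj g).toMonoidHom = M'.map (MulAut.conj g').toMonoidHom by
      intro z
      have h := SetLike.ext_iff.1 hmap (g * z * g⁻¹)
      rw [Subgroup.mem_map_equiv, Subgroup.mem_map_equiv] at h
      simpa [mul_assoc] using h
    by_contra hne
    have h := hinf _ _ (hM.map_conj g) (hM'.map_conj g') hne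
    have h1 : g * m * g⁻¹ ∈ M.map (MulAut.conj g).toMonoidHom := ⟨m, hm, by simp⟩
    have h2 : g * m * g⁻¹ ∈ M'.map (MulAut.conj g').toMonoidHom := ⟨m', hm', by simp [he]⟩
    have h3 : g * m * g⁻¹ ∈ (⊥ : Subgroup G) := h ▸ ⟨h1, h2⟩
    exact hm1 (conj_eq_one_iff.1 (Subgroup.mem_bot.1 h3))
  have hinj : ∀ M : Subgroup G, IsCoatom M → Function.Injective (cosetConj M) := by
    rintro M hM ⟨x, ⟨m, hm⟩, hm1⟩ ⟨y, ⟨m', hm'⟩, hm1'⟩ he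
    have he : x.out * m * x.out⁻¹ = y.out * m' * y.out⁻¹ := congrArg Subtype.val he
    have hne : m ≠ 1 := fun h => hm1 (Subtype.ext h)
    have hc := hconj M M hM hM _ _ m hm m' hm' hne he
    have hk : y.out⁻¹ * x.out ∈ Subgroup.normalizer (M : Set G) :=
      Subgroup.mem_normalizer_iff.2 hc
    have hxy : y = x := by
      rw [← x.out_eq', ← y.out_eq']
      refine QuotientGroup.eq.2 ?_
      rwa [hnorm M hM] at hk
    subst hxy
    simpa using he
  have hcard : ∀ M : Subgroup G, Nat.card ((G ⧸ M) × {m : M // m ≠ 1}) + M.index = Nat.card G := by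
    intro M
    have h := M.index_mul_card
    have h1 : Nat.card {m : M // m ≠ 1} + 1 = Nat.card M := by
      classical
      have := Fintype.ofFinite M
      rw [Nat.card_eq_fintype_card, Nat.card_eq_fintype_card, Fintype.card_subtype_compl,
        Fintype.card_subtype_eq]
      exact Nat.sub_add_cancel Fintype.card_pos
    rw [Nat.card_prod, ← Subgroup.index_eq_card, ← h, ← h1, Nat.mul_add, Nat.mul_one]
  have hcard1 : Nat.card {g : G // g ≠ 1} + 1 = Nat.card G := by
    classical
    have := Fintype.ofFinite G
    rw [Nat.card_eq_fintype_card, Nat.card_eq_fintype_card, Fintype.card_subtype_compl,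
      Fintype.card_subtype_eq]
    exact Nat.sub_add_cancel Fintype.card_pos
  have hindex : ∀ M : Subgroup G, IsCoatom M → 2 * M.index ≤ Nat.card G := by
    intro M hM
    have h := M.index_mul_card
    have h2 : 1 < Nat.card M := Subgroup.one_lt_card_iff_ne_bot M |>.2 (hbot M hM)
    nlinarith
  obtain ⟨M, hM, -⟩ := hmem 1
  have hnsurj : ¬ Function.Surjective (cosetConj M) := by
    intro hs
    have h1 := Nat.card_le_card_of_surjective _ hs
    have h2 := hcard M
    have h3 : M.index ≠ 1 := fun h => hM.1 (Subgroup.index_eq_one.1 h)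
    have h4 : M.index ≠ 0 := Subgroup.index_ne_zero_of_finite
    omega
  simp only [Function.Surjective, not_forall, not_exists] at hnsurj
  obtain ⟨⟨g, hg1⟩, hg⟩ := hnsurj
  obtain ⟨M', hM', hgM'⟩ := hmem g
  have hdisj : ∀ x y, cosetConj M x ≠ cosetConj M' y := by
    rintro ⟨x, ⟨m, hm⟩, hm1⟩ ⟨y, ⟨m', hm'⟩, hm1'⟩ he
    have he : x.out * m * x.out⁻¹ = y.out * m' * y.out⁻¹ := congrArg Subtype.val he
    have hne : m ≠ 1 := fun h => hm1 (Subtype.ext h)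
    have hc := hconj M M' hM hM' _ _ m hm m' hm' hne he
    set k := y.out⁻¹ * x.out
    have hz : k⁻¹ * g * k ∈ M := (hc _).2 (by simpa [mul_assoc] using hgM')
    obtain ⟨h, hh⟩ := QuotientGroup.mk_out_eq_mul M k
    refine hg ⟨(k : G ⧸ M), ⟨h⁻¹ * ⟨k⁻¹ * g * k, hz⟩ * h, ?_⟩⟩ (Subtype.ext ?_)
    · intro h1
      have h2 := congrArg Subtype.val h1
      apply hg1
      have h3 : (k * h : G)⁻¹ * g * (k * h : G)⁻¹⁻¹ = 1 := by simpa [mul_assoc] using h2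
      exact conj_eq_one_iff.1 h3
    · simp only [cosetConj, hh]
      simp [mul_assoc]
  have h1 := Nat.card_le_card_of_injective (Sum.elim (cosetConj M) (cosetConj M'))
    ((hinj M hM).sumElim (hinj M' hM') hdisj)
  rw [Nat.card_sum] at h1
  have := hcard M
  have := hcard M'
  have := hindex M hM
  have := hindex M' hM'
  omega

/-- The elements of exponent dividing `q` in the center of `K`. -/
def centerTorsion (K : Subgroup G) (q : ℕ) : Subgroup G where
  carrier := {x | x ∈ K ∧ (∀ y ∈ K, x * y = y * x) ∧ x ^ q = 1}
  one_mem' := ⟨K.one_mem, by simp, one_pow q⟩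
  mul_mem' := by
    rintro a b ⟨ha, hac, haq⟩ ⟨hb, hbc, hbq⟩
    refine ⟨K.mul_mem ha hb, fun y hy => ?_, ?_⟩
    · rw [mul_assoc, hbc y hy, ← mul_assoc, hac y hy, mul_assoc]
    · rw [Commute.mul_pow (hac b hb), haq, hbq, one_mul]
  inv_mem' := by
    rintro a ⟨ha, hac, haq⟩
    exact ⟨K.inv_mem ha, fun y hy => (Commute.inv_left (hac y hy)), by rw [inv_pow, haq, inv_one]⟩

instance (K : Subgroup G) [hK : K.Normal] (q : ℕ) : (centerTorsion K q).Normal where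
  conj_mem := by
    rintro a ⟨ha, hac, haq⟩ g
    refine ⟨hK.conj_mem a ha g, fun y hy => ?_, by rw [conj_pow, haq]; simp⟩
    have h := hac (g⁻¹ * y * g) (by simpa using hK.conj_mem y hy g⁻¹)
    have h' := congrArg (fun z => g * z * g⁻¹) h
    simpa [mul_assoc] using h'

/-- The center is trivial and `G` is not simple, so a proper normal `K` yields `N` inside its
center. If `G` acted on `N` as a `q`-group, it would fix a nonidentity point, which would be
central; Cauchy's theorem then provides `c`. -/
theorem exists_coprime_action_of_minimal (hG : ¬ Group.IsNilpotent G)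
    (hmin : ∀ M : Subgroup G, M ≠ ⊤ → Group.IsNilpotent M)
    (hquot : ∀ (N : Subgroup G) [N.Normal], N ≠ ⊥ → Group.IsNilpotent (G ⧸ N)) :
    ∃ (p q : ℕ) (_ : p.Prime) (_ : q.Prime) (N : Subgroup G) (_ : N.Normal) (c : G), p ≠ q ∧
      (∀ x ∈ N, ∀ y ∈ N, x * y = y * x) ∧ (∀ x ∈ N, x ^ q = 1) ∧
      (MulAut.conjNormal c : MulAut N) ^ p = 1 ∧ (MulAut.conjNormal c : MulAut N) ≠ 1 := by
  have hcenter : Subgroup.center G = ⊥ := by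
    by_contra h
    exact hG (Group.of_quotient_center_nilpotent (hquot _ h))
  have hnt : Nontrivial G := by
    by_contra h
    rw [not_nontrivial_iff_subsingleton] at h
    exact hG inferInstance
  obtain ⟨K, hK, hKbot, hKtop⟩ : ∃ K : Subgroup G, K.Normal ∧ K ≠ ⊥ ∧ K ≠ ⊤ := by
    by_contra! h
    have : IsSimpleGroup G := ⟨fun K hK => or_iff_not_imp_left.2 (h K hK)⟩
    exact hG (isNilpotent_of_simple hmin)
  have := hmin K hKtop
  have : Nontrivial K := K.nontrivial_iff_ne_bot.2 hKbot
  have hc : Subgroup.center K ≠ ⊥ := Group.IsNilpotent.center_ne_bot K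
  obtain ⟨q, hq, hqd⟩ := Nat.exists_prime_and_dvd
    (Subgroup.one_lt_card_iff_ne_bot (Subgroup.center K) |>.2 hc).ne'
  have := Fact.mk hq
  set N := centerTorsion K q
  have hNbot : N ≠ ⊥ := by
    obtain ⟨⟨⟨x, hxK⟩, hx⟩, hxo⟩ := exists_prime_orderOf_dvd_card' q hqd
    rw [Subgroup.orderOf_mk, Subgroup.orderOf_mk] at hxo
    intro h
    have hxN : x ∈ N := by
      refine ⟨hxK, fun y hy => ?_, hxo ▸ pow_orderOf_eq_one x⟩
      exact (congrArg Subtype.val (Subgroup.mem_center_iff.1 hx ⟨y, hy⟩)).symm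
    rw [h, Subgroup.mem_bot] at hxN
    rw [hxN, orderOf_one] at hxo
    exact hq.one_lt.ne hxo
  set R := (MulAut.conjNormal : G →* MulAut N).range
  by_cases hp : ∃ p, p.Prime ∧ p ∣ Nat.card R ∧ p ≠ q
  · obtain ⟨p, hp, hpd, hpq⟩ := hp
    have := Fact.mk hp
    obtain ⟨⟨r, hrR⟩, hr⟩ := exists_prime_orderOf_dvd_card' p hpd
    rw [Subgroup.orderOf_mk] at hr
    obtain ⟨c, rfl⟩ := hrR
    refine ⟨p, q, hp, hq, N, inferInstance, c, hpq, fun x hx y hy => hx.2.1 y hy.1,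
      fun x hx => hx.2.2, hr ▸ pow_orderOf_eq_one _, fun h => ?_⟩
    rw [h, orderOf_one] at hr
    exact hp.one_lt.ne hr
  · exfalso
    push Not at hp
    have hRq : IsPGroup q R := IsPGroup.of_card
      (Nat.eq_prime_pow_of_unique_prime_dvd Nat.card_pos.ne' fun {d} hd hdd => hp d hd hdd)
    have hNq : IsPGroup q N := fun x => ⟨1, by
      rw [pow_one]
      exact Subtype.ext x.2.2.2⟩
    have hNd : q ∣ Nat.card N := hNq.card_eq_or_dvd.resolve_left
      (Subgroup.one_lt_card_iff_ne_bot N |>.2 hNbot).ne'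
    obtain ⟨b, hb, hb1⟩ := hRq.exists_fixed_point_of_prime_dvd_card_of_fixed_point N hNd
      (a := 1) (fun r => smul_one r)
    apply hb1
    have : (b : G) ∈ Subgroup.center G := by
      rw [Subgroup.mem_center_iff]
      intro g
      have h := congrArg Subtype.val (hb ⟨_, g, rfl⟩)
      have h' : g * b * g⁻¹ = b := h
      exact mul_inv_eq_iff_eq_mul.1 h'
    rw [hcenter, Subgroup.mem_bot] at this
    exact Subtype.ext this.symm

end MinimalNonnilpotent

/-! ### Laws inherited by sections. -/

/-- Every identity between products of group variables that holds in `G` also holds in `H`. -/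
def InheritsLaws (G : Type*) [Group G] (H : Type*) [Group H] : Prop :=
  ∀ (n : ℕ) (l₁ l₂ : List (Fin n)), (∀ g : Fin n → G, (l₁.map g).prod = (l₂.map g).prod) →
    ∀ h : Fin n → H, (l₁.map h).prod = (l₂.map h).prod

namespace InheritsLaws

variable {G : Type*} [Group G] {H : Type*} [Group H]

theorem subgroup (h : InheritsLaws G H) (K : Subgroup H) : InheritsLaws G K := by
  intro n l₁ l₂ hl k
  have := h n l₁ l₂ hl fun i => k i
  apply Subtype.ext
  simpa [Subgroup.val_list_prod, List.map_map, Function.comp_def] using this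

theorem quotient (h : InheritsLaws G H) (K : Subgroup H) [K.Normal] :
    InheritsLaws G (H ⧸ K) := by
  intro n l₁ l₂ hl k
  have := congrArg (QuotientGroup.mk' K) (h n l₁ l₂ hl fun i => (k i).out)
  simpa [map_list_prod, List.map_map, Function.comp_def] using this

end InheritsLaws

theorem exists_section_coprime_action {G : Type u} [Group G] [Finite G]
    (hG : ¬ Group.IsNilpotent G) :
    ∃ (H : Type u) (_ : Group H), InheritsLaws G H ∧
    ∃ (p q : ℕ) (_ : p.Prime) (_ : q.Prime) (N : Subgroup H) (_ : N.Normal) (c : H), p ≠ q ∧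
      (∀ x ∈ N, ∀ y ∈ N, x * y = y * x) ∧ (∀ x ∈ N, x ^ q = 1) ∧
      (MulAut.conjNormal c : MulAut N) ^ p = 1 ∧ (MulAut.conjNormal c : MulAut N) ≠ 1 := by
  classical
  have hex : ∃ k : ℕ, ∃ (H : Type u) (_ : Group H), Finite H ∧ InheritsLaws G H ∧
      ¬ Group.IsNilpotent H ∧ Nat.card H = k :=
    ⟨_, G, inferInstance, inferInstance, fun _ _ _ h => h, hG, rfl⟩
  obtain ⟨H, _, _, hlaw, hH, hcard⟩ := Nat.find_spec hex
  have hsmall : ∀ (K : Type u) [Group K] [Finite K], InheritsLaws G K → Nat.card K < Nat.card H →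
      Group.IsNilpotent K := by
    intro K _ _ hK hlt
    by_contra hnil
    exact Nat.find_min hex (hcard ▸ hlt) ⟨K, inferInstance, inferInstance, hK, hnil, rfl⟩
  refine ⟨H, inferInstance, hlaw, exists_coprime_action_of_minimal hH (fun M hM => ?_)
    fun N _ hN => ?_⟩
  · refine hsmall M (hlaw.subgroup M) (lt_of_le_of_ne (Subgroup.card_le_card_group M) fun h => ?_)
    exact hM (Subgroup.eq_top_of_card_eq M h)
  · refine hsmall (H ⧸ N) (hlaw.quotient N) ?_
    have h := N.card_eq_card_quotient_mul_card_subgroup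
    have h2 := Subgroup.one_lt_card_iff_ne_bot N |>.2 hN
    have h3 : 0 < Nat.card (H ⧸ N) := Nat.card_pos
    nlinarith

/-! ### Fourier inversion with operator-valued characters. -/

/-- The powers of an element `D` with `D ^ p = 1`, indexed by `ZMod p`. -/
def zmodPow {R : Type*} [Monoid R] {p : ℕ} (D : R) (a : ZMod p) : R := D ^ a.val

theorem zmodPow_natCast {R : Type*} [Monoid R] {p : ℕ} {D : R} (hD : D ^ p = 1) (k : ℕ) :
    zmodPow D (k : ZMod p) = D ^ k := by
  rw [zmodPow, ZMod.val_natCast, ← pow_eq_pow_mod k hD]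

theorem zmodPow_add {R : Type*} [Monoid R] {p : ℕ} [NeZero p] {D : R} (hD : D ^ p = 1)
    (a b : ZMod p) : zmodPow D (a + b) = zmodPow D a * zmodPow D b := by
  rw [← ZMod.natCast_zmod_val a, ← ZMod.natCast_zmod_val b, ← Nat.cast_add, zmodPow_natCast hD,
    zmodPow_natCast hD, zmodPow_natCast hD, pow_add]

open Finset in
/-- Fourier inversion: if `f` pairs to zero with all characters `e ↦ D ^ (t ⬝ᵥ e)`, then `f`
vanishes modulo `q`. -/
theorem dvd_of_sum_zmodPow_eq_zero {M : Type*} [AddCommGroup M] {p q : ℕ} [Fact p.Prime]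
    [Fact q.Prime] (hpq : p ≠ q) (hM : ∀ u : M, q • u = 0) {D : AddMonoid.End M} (hDp : D ^ p = 1)
    (hD : D ≠ 1) {ι : Type*} [Fintype ι] [DecidableEq ι] (f : (ι → ZMod p) → ℤ)
    (hf : ∀ (t : ι → ZMod p) (u : M), ∑ e, f e • zmodPow D (t ⬝ᵥ e) u = 0) (e₀ : ι → ZMod p) :
    (q : ℤ) ∣ f e₀ := by
  classical
  obtain ⟨u, hu⟩ : ∃ u, D u ≠ u := by
    by_contra! h
    exact hD (AddMonoidHom.ext h)
  -- For `e ≠ e₀`, shifting `t` by a vector that pairs to `1` with `e - e₀` multiplies the summand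
  -- by `D`, so applying the sum to `D u` or to `u` gives the same result.
  have hsum : ∀ e, ∑ t : ι → ZMod p, zmodPow D (t ⬝ᵥ (e - e₀)) (D u - u) =
      if e = e₀ then Fintype.card (ι → ZMod p) • (D u - u) else 0 := by
    intro e
    split_ifs with he
    · simp [he, zmodPow, Finset.card_univ, smul_sub]
    · obtain ⟨k, hk⟩ := Function.ne_iff.1 he
      have hk' : e k - e₀ k ≠ 0 := sub_ne_zero.2 hk
      simp only [map_sub, sum_sub_distrib]
      rw [sub_eq_zero]
      refine Fintype.sum_equiv (Equiv.addRight (Pi.single k (e k - e₀ k)⁻¹)) _ _ fun t => ?_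
      have h1 : Pi.single k (e k - e₀ k)⁻¹ ⬝ᵥ (e - e₀) = ((1 : ℕ) : ZMod p) := by
        rw [single_dotProduct, Pi.sub_apply, inv_mul_cancel₀ hk', Nat.cast_one]
      rw [Equiv.coe_addRight, add_dotProduct, h1, zmodPow_add hDp, zmodPow_natCast hDp, pow_one]
      rfl
  have hzero : ∑ e, f e • ∑ t : ι → ZMod p, zmodPow D (t ⬝ᵥ (e - e₀)) (D u - u) = 0 := by
    simp only [smul_sum]
    rw [sum_comm]
    refine sum_eq_zero fun t _ => ?_
    have h := congrArg (⇑(zmodPow D (-(t ⬝ᵥ e₀)))) (hf t (D u - u))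
    rw [map_sum, map_zero] at h
    rw [← h]
    refine sum_congr rfl fun e _ => ?_
    rw [map_zsmul, dotProduct_sub, sub_eq_neg_add, zmodPow_add hDp]
    rfl
  simp only [hsum, smul_ite, smul_zero, sum_ite_eq', mem_univ, if_true] at hzero
  have hord : addOrderOf (D u - u) = q :=
    addOrderOf_eq_prime (hM _) (sub_ne_zero.2 hu)
  rw [← natCast_zsmul, smul_smul, ← addOrderOf_dvd_iff_zsmul_eq_zero, hord] at hzero
  refine (Int.Prime.dvd_mul' Fact.out hzero).resolve_right fun h => ?_
  have h2 : q ∣ p ^ Fintype.card ι := by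
    have := Int.natCast_dvd_natCast.1 h
    rwa [Fintype.card_fun, ZMod.card] at this
  exact hpq ((Nat.prime_dvd_prime_iff_eq Fact.out Fact.out).1
    (Nat.Prime.dvd_of_dvd_pow Fact.out h2)).symm

theorem mul_pow_of_mul_eq {H M : Type*} [Group H] [AddCommGroup M] {j : Multiplicative M →* H}
    {c : H} {D : AddMonoid.End M} (hj : ∀ u, j (.ofAdd u) * c = c * j (.ofAdd (D u))) (k : ℕ) :
    ∀ u, j (.ofAdd u) * c ^ k = c ^ k * j (.ofAdd ((D ^ k) u)) := by
  induction k with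
  | zero => simp
  | succ k ih =>
    intro u
    rw [pow_succ, ← mul_assoc, ih, mul_assoc, hj, ← mul_assoc, pow_succ']
    rfl

/-! ### Invariants of words read off from the laws. -/

section Words

variable {ι : Type*} [DecidableEq ι] {p : ℕ}

/-- The translation attached to a letter of the alphabet `Option ι`. -/
def letterShift (p : ℕ) : Option ι → ι → ZMod p
  | none => 0
  | some i => Pi.single i 1

/-- The total translation of a word. -/
def wordShift (p : ℕ) (l : List (Option ι)) : ι → ZMod p :=
  (l.map (letterShift p)).sum

/-- The number of occurrences of `none` in a word followed by a suffix with translation `g`. -/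
def countAt (p : ℕ) [Fintype ι] (g : ι → ZMod p) : List (Option ι) → ℕ
  | [] => 0
  | none :: l => countAt p g l + if wordShift p l = g then 1 else 0
  | some _ :: l => countAt p g l

theorem wordShift_cons (o : Option ι) (l : List (Option ι)) :
    wordShift p (o :: l) = letterShift p o + wordShift p l := by
  simp [wordShift]

variable [Fintype ι] {H : Type*} [Group H] {M : Type*} [AddCommGroup M]

/-- Collect the powers of `c` on the left: a factor from `M` then crosses its suffix, of translation
`e`, and picks up `D ^ (t ⬝ᵥ e)`. -/
theorem exists_prod_eq [Fact p.Prime] {j : Multiplicative M →* H} {c : H} {D : AddMonoid.End M}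
    (hDp : D ^ p = 1)
    (hj : ∀ u, j (.ofAdd u) * c = c * j (.ofAdd (D u))) (t : ι → ZMod p) (l : List (Option ι)) :
    ∃ k : ℕ, (k : ZMod p) = t ⬝ᵥ wordShift p l ∧ ∀ u : M,
      (l.map fun o => o.elim (j (.ofAdd u)) fun i => c ^ (t i).val).prod =
        c ^ k * j (.ofAdd (∑ e, countAt p e l • zmodPow D (t ⬝ᵥ e) u)) := by
  have hjk := mul_pow_of_mul_eq hj
  induction l with
  | nil => exact ⟨0, by simp [wordShift], by simp [countAt]⟩
  | cons o l ih =>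
    obtain ⟨k, hk, h⟩ := ih
    cases o with
    | none =>
      refine ⟨k, by rw [hk, wordShift_cons]; simp [letterShift], fun u => ?_⟩
      rw [List.map_cons, List.prod_cons, h, Option.elim_none, ← mul_assoc, hjk, mul_assoc,
        ← map_mul, ← ofAdd_add]
      congr 4
      simp only [countAt, add_smul, Finset.sum_add_distrib, ite_smul, one_smul, zero_smul,
        Finset.sum_ite_eq, Finset.mem_univ, if_true]
      rw [add_comm, ← hk, zmodPow_natCast hDp]
    | some i =>
      refine ⟨(t i).val + k, ?_, fun u => ?_⟩
      · rw [wordShift_cons, dotProduct_add, Nat.cast_add, hk, ZMod.natCast_zmod_val]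
        simp [letterShift]
      · rw [List.map_cons, List.prod_cons, h, Option.elim_some, pow_add, mul_assoc]
        rfl

theorem wordShift_eq_and_countAt_modEq {q : ℕ} [Fact p.Prime] [Fact q.Prime] (hpq : p ≠ q)
    (hM : ∀ u : M, q • u = 0) {j : Multiplicative M →* H} (hjinj : Function.Injective j) {c : H}
    {D : AddMonoid.End M} (hDp : D ^ p = 1) (hD : D ≠ 1)
    (hj : ∀ u, j (.ofAdd u) * c = c * j (.ofAdd (D u))) (l₁ l₂ : List (Option ι))
    (hl : ∀ h : Option ι → H, (l₁.map h).prod = (l₂.map h).prod) :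
    wordShift p l₁ = wordShift p l₂ ∧ ∀ e, countAt p e l₁ ≡ countAt p e l₂ [MOD q] := by
  have hjk := mul_pow_of_mul_eq hj
  -- The order of `c` may exceed `p`, but the action `D` has order exactly `p`.
  have hcpow : ∀ a b : ℕ, c ^ a = c ^ b → (a : ZMod p) = b := by
    intro a b hab
    obtain ⟨d, hd⟩ := IsUnit.of_pow_eq_one hDp (NeZero.ne p)
    rw [ZMod.natCast_eq_natCast_iff, ← orderOf_eq_prime hDp hD, ← hd, orderOf_units,
      ← pow_eq_pow_iff_modEq, Units.ext_iff, Units.val_pow_eq_pow_val, Units.val_pow_eq_pow_val, hd]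
    refine AddMonoidHom.ext fun u => ?_
    have h := hjk a u
    rw [hab, hjk b u] at h
    exact (Multiplicative.ofAdd.injective (hjinj (mul_left_cancel h))).symm
  have key : ∀ t : ι → ZMod p, t ⬝ᵥ wordShift p l₁ = t ⬝ᵥ wordShift p l₂ ∧ ∀ u : M,
      ∑ e, countAt p e l₁ • zmodPow D (t ⬝ᵥ e) u = ∑ e, countAt p e l₂ • zmodPow D (t ⬝ᵥ e) u := by
    intro t
    obtain ⟨k₁, hk₁, h₁⟩ := exists_prod_eq hDp hj t l₁
    obtain ⟨k₂, hk₂, h₂⟩ := exists_prod_eq hDp hj t l₂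
    have hc : c ^ k₁ = c ^ k₂ := by
      have h1 := h₁ 0
      have h2 := h₂ 0
      simp only [map_zero, smul_zero, Finset.sum_const_zero, ofAdd_zero, map_one, mul_one] at h1 h2
      rw [← h1, ← h2, hl]
    refine ⟨by rw [← hk₁, ← hk₂, hcpow _ _ hc], fun u => ?_⟩
    have h := hl fun o => o.elim (j (.ofAdd u)) fun i => c ^ (t i).val
    rw [h₁, h₂, hc] at h
    exact Multiplicative.ofAdd.injective (hjinj (mul_left_cancel h))
  refine ⟨funext fun i => ?_, fun e => ?_⟩
  · simpa using (key (Pi.single i 1)).1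
  · refine (Nat.modEq_iff_dvd.2 ?_).symm
    refine dvd_of_sum_zmodPow_eq_zero hpq hM hDp hD
      (fun e => (countAt p e l₁ : ℤ) - countAt p e l₂) (fun t u => ?_) e
    simp only [sub_smul, natCast_zsmul, Finset.sum_sub_distrib]
    rw [(key t).2 u, sub_self]

end Words

theorem exists_primes_wordShift_eq_and_countAt_modEq {G : Type u} [Group G] [Finite G]
    (hG : ¬ Group.IsNilpotent G) :
    ∃ (p q : ℕ), p.Prime ∧ q.Prime ∧ ∀ (n : ℕ) (l₁ l₂ : List (Fin n)),
      (∀ g : Fin n → G, (l₁.map g).prod = (l₂.map g).prod) →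
      ∀ {ι : Type} [Fintype ι] [DecidableEq ι] (σ : Fin n → Option ι),
        wordShift p (l₁.map σ) = wordShift p (l₂.map σ) ∧
          ∀ e, countAt p e (l₁.map σ) ≡ countAt p e (l₂.map σ) [MOD q] := by
  obtain ⟨H, _, hlaw, p, q, hp, hq, N, hN, c, hpq, hcomm, hexp, hcp, hc⟩ :=
    exists_section_coprime_action hG
  have := Fact.mk hp
  have := Fact.mk hq
  refine ⟨p, q, hp, hq, fun n l₁ l₂ hl ι _ _ σ => ?_⟩
  let : CommGroup N := { mul_comm := fun x y => Subtype.ext (hcomm x x.2 y y.2) }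
  let ρ : MulAut N →* AddMonoid.End (Additive N) :=
    (monoidEndToAdditive N : _ →* _).comp (MulDistribMulAction.toMonoidEnd (MulAut N) N)
  have hρ : ∀ (a : MulAut N) (u : Additive N), ρ a u = .ofMul (a u.toMul) := fun _ _ => rfl
  -- The inverse appears because `u * c = c * (c⁻¹ * u * c)`.
  refine wordShift_eq_and_countAt_modEq (M := Additive N) hpq (fun u => ?_)
    (j := N.subtype.comp (MulEquiv.multiplicativeAdditive N).toMonoidHom) ?_ (c := c)
    (D := ρ (MulAut.conjNormal c)⁻¹) ?_ ?_ (fun u => ?_) _ _ fun h => ?_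
  · exact congrArg Additive.ofMul (Subtype.ext (hexp u.toMul u.toMul.2) : u.toMul ^ q = 1)
  · exact N.subtype_injective.comp (MulEquiv.multiplicativeAdditive N).injective
  · rw [← map_pow, inv_pow, hcp, inv_one, map_one]
  · intro h
    apply hc
    rw [← inv_eq_one]
    exact MulEquiv.ext fun x => congrArg Additive.toMul (DFunLike.congr_fun h (.ofMul x))
  · rw [hρ, ← map_inv]
    change (u.toMul : H) * c = c * ((MulAut.conjNormal c⁻¹ u.toMul : N) : H)
    rw [MulAut.conjNormal_apply]
    simp [mul_assoc]
  · rw [List.map_map, List.map_map]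
    exact hlaw n l₁ l₂ hl (h ∘ σ)

/-! ### Terms and identities of the algebra. -/

namespace GroupActionAlgebra

/-- The left variable, the word of acting variables and the right variable of a term. -/
def termData {α : Type*} : signature.Term α → α × List α × α
  | .var i => (i, [], i)
  | .func (l := _) op ts => match op, ts with
    | OpSymbol.f, ts => let r := termData (ts 0); (r.1, r.1 :: r.2.1, r.2.2)
    | OpSymbol.d, ts => ((termData (ts 0)).1, (termData (ts 1)).2)

/-- The algebra on `P × Q` attached to an operation `P → Q → Q`. -/
def ActAlg {P : Type u} {Q : Type v} (_act : P → Q → Q) : Type (max u v) := P × Q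

instance {P : Type u} {Q : Type v} (act : P → Q → Q) : signature.Structure (ActAlg act) where
  funMap {_} op := match op with
    | OpSymbol.f => fun x => ((x 0).1, act (x 0).1 (x 0).2)
    | OpSymbol.d => fun x => ((x 0).1, (x 1).2)
  RelMap := fun r => Empty.elim r

theorem realize_actAlg {P : Type u} {Q : Type v} (act : P → Q → Q) {α : Type*}
    (x : α → ActAlg act) (t : signature.Term α) :
    t.realize x = ((x (termData t).1).1,
      (termData t).2.1.foldr (fun i => act (x i).1) (x (termData t).2.2).2) := by
  induction t with
  | var i => rfl
  | func op ts ih =>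
    rw [FirstOrder.Language.Term.realize_func]
    cases op with
    | f =>
      change (((ts 0).realize x).1, act ((ts 0).realize x).1 ((ts 0).realize x).2) = _
      rw [ih 0]
      rfl
    | d =>
      change (((ts 0).realize x).1, ((ts 1).realize x).2) = _
      rw [ih 0, ih 1]
      rfl

theorem foldr_smul {G S α : Type*} [Group G] [MulAction G S] (g : α → G) (l : List α) (s : S) :
    l.foldr (fun i => (g i • ·)) s = (l.map g).prod • s := by
  induction l with
  | nil => simp
  | cons i l ih => simp [ih, mul_smul]

/-- `Alg G S` is the algebra attached to the operation `(g, s) ↦ g • s`. -/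
theorem realize_alg {G : Type u} {S : Type v} [Group G] [MulAction G S] {α : Type*}
    (x : α → Alg G S) (t : signature.Term α) :
    t.realize x = ((x (termData t).1).1,
      ((termData t).2.1.map fun i => (x i).1).prod • (x (termData t).2.2).2) := by
  rw [← foldr_smul]
  exact realize_actAlg (fun (g : G) (s : S) => g • s) x t

theorem termData_of_satisfies {G : Type u} {S : Type v} [Group G] [Nontrivial G]
    [MulAction G S] [FaithfulSMul G S] {n : ℕ} {s t : signature.Term (Fin n)}
    (h : Satisfies signature (Alg G S) s t) :
    (termData s).1 = (termData t).1 ∧ (termData s).2.2 = (termData t).2.2 ∧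
      ∀ g : Fin n → G, ((termData s).2.1.map g).prod = ((termData t).2.1.map g).prod := by
  have h1 : ∀ (g : Fin n → G) (y : Fin n → S), g (termData s).1 = g (termData t).1 ∧
      ((termData s).2.1.map g).prod • y (termData s).2.2 =
        ((termData t).2.1.map g).prod • y (termData t).2.2 := by
    intro g y
    let z : Fin n → Alg G S := fun i => (g i, y i)
    exact Prod.mk.inj ((realize_alg z s).symm.trans ((h z).trans (realize_alg z t)))
  obtain ⟨g₀, hg₀⟩ := exists_ne (1 : G)
  obtain ⟨s₀, hs₀⟩ : ∃ s₀ : S, g₀ • s₀ ≠ s₀ := by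
    by_contra! hs
    exact hg₀ (FaithfulSMul.eq_of_smul_eq_smul fun a => (hs a).trans (one_smul G a).symm)
  have hright : (termData s).2.2 = (termData t).2.2 := by
    by_contra hne
    -- With trivial group components, only the right variables are compared.
    have h2 := (h1 (fun _ => 1) (fun i => if i = (termData s).2.2 then g₀ • s₀ else s₀)).2
    simp only [List.map_const', List.prod_replicate, one_pow, one_smul, if_true,
      if_neg (Ne.symm hne)] at h2
    exact hs₀ h2
  refine ⟨?_, hright, fun g => FaithfulSMul.eq_of_smul_eq_smul (α := S) fun a => ?_⟩
  · by_contra hne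
    have h2 := (h1 (fun i => if i = (termData s).1 then g₀ else 1) fun _ => s₀).1
    simp only [if_true, if_neg (Ne.symm hne)] at h2
    exact hg₀ h2
  · exact (h1 g fun _ => a).2

/-! ### The tower action. -/

theorem wordShift_apply_of_notMem {ι : Type*} [DecidableEq ι] {p : ℕ} {k : ι}
    {l : List (Option ι)} (hl : some k ∉ l) :
    wordShift p l k = 0 := by
  induction l with
  | nil => simp [wordShift]
  | cons o l ih =>
    simp only [List.mem_cons, not_or] at hl
    rw [wordShift_cons, Pi.add_apply, ih hl.2]
    cases o with
    | none => simp [letterShift]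
    | some i =>
      have : k ≠ i := fun h => hl.1 (congrArg some h)
      simp [letterShift, this]

section Construction

variable {ι : Type} [Fintype ι] [DecidableEq ι] {p : ℕ} {Z : Type}

/-- `some i` translates by the `i`-th basis vector, and `none` applies `x` over the translation
`0` and `y` over the translation `1`. -/
def towerAct (p : ℕ) (ι : Type) [Fintype ι] [DecidableEq ι] (x y : Equiv.Perm Z) :
    Option ι → Z × (ι → ZMod p) → Z × (ι → ZMod p)
  | some i, (z, e) => (z, letterShift p (some i) + e)
  | none, (z, e) => (if e = 0 then x z else if e = 1 then y z else z, e)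

variable {x y : Equiv.Perm Z}

theorem foldr_towerAct_of_none (l : List (Option ι)) (hl : none ∉ l) (z : Z) (e : ι → ZMod p) :
    l.foldr (towerAct p ι x y) (z, e) = (z, wordShift p l + e) := by
  induction l with
  | nil => simp [wordShift]
  | cons o l ih =>
    cases o with
    | none => simp at hl
    | some i =>
      rw [List.foldr_cons, ih (fun h => hl (List.mem_cons_of_mem _ h)), wordShift_cons, add_assoc]
      rfl

/-- Coordinate `k` of the translation stays `e k`, so `0` is reachable only if `e k = 0` and `1`
only if it is not. A `none` acts by `x` when its suffix translates by `-e`, and by `y` when it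
translates by `1 - e`. -/
theorem foldr_towerAct_of_some [Fact p.Prime] {k : ι} (l : List (Option ι)) (hl : some k ∉ l)
    (z : Z) (e : ι → ZMod p) :
    l.foldr (towerAct p ι x y) (z, e) =
      (if e k = 0 then (x ^ countAt p (-e) l) z else (y ^ countAt p (1 - e) l) z,
        wordShift p l + e) := by
  induction l with
  | nil => simp [wordShift, countAt]
  | cons o l ih =>
    simp only [List.mem_cons, not_or] at hl
    rw [List.foldr_cons, ih hl.2, wordShift_cons, add_assoc]
    cases o with
    | some i => rfl
    | none =>
      have hk : (wordShift p l + e) k = e k := by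
        rw [Pi.add_apply, wordShift_apply_of_notMem hl.2, zero_add]
      simp only [towerAct, letterShift, zero_add, countAt, eq_neg_iff_add_eq_zero,
        eq_sub_iff_add_eq, Prod.mk.injEq, and_true]
      by_cases h : e k = 0
      · have h1 : wordShift p l + e ≠ 1 := fun h1 => by
          rw [h1, h, Pi.one_apply] at hk
          exact one_ne_zero hk
        by_cases h0 : wordShift p l + e = 0 <;> simp [h, h0, h1, pow_succ']
      · have h0 : wordShift p l + e ≠ 0 := fun h0 => h (by rw [← hk, h0, Pi.zero_apply])
        by_cases h1 : wordShift p l + e = 1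
        · have h2 : (1 : ι → ZMod p) ≠ 0 := h1 ▸ h0
          simp [h, h1, h2, pow_succ']
        · simp [h, h0, h1]

theorem foldr_towerAct_congr [Fact p.Prime] {q : ℕ} (hx : x ^ q = 1) (hy : y ^ q = 1)
    {l₁ l₂ : List (Option ι)} {o : Option ι} (h₁ : o ∉ l₁) (h₂ : o ∉ l₂)
    (hshift : wordShift p l₁ = wordShift p l₂)
    (hcount : ∀ e, countAt p e l₁ ≡ countAt p e l₂ [MOD q]) (a : Z × (ι → ZMod p)) :
    l₁.foldr (towerAct p ι x y) a = l₂.foldr (towerAct p ι x y) a := by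
  obtain ⟨z, e⟩ := a
  cases o with
  | none => rw [foldr_towerAct_of_none l₁ h₁, foldr_towerAct_of_none l₂ h₂, hshift]
  | some k =>
    have hpow : ∀ {w : Equiv.Perm Z} (e), w ^ q = 1 → w ^ countAt p e l₁ = w ^ countAt p e l₂ := by
      intro w e hw
      rw [pow_eq_pow_mod _ hw, hcount e, ← pow_eq_pow_mod _ hw]
    rw [foldr_towerAct_of_some l₁ h₁, foldr_towerAct_of_some l₂ h₂, hshift, hpow _ hx, hpow _ hy]

/-- A set closed under `towerAct` is closed under all translations and under `x` and `y`. -/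
theorem eq_univ_of_towerAct_mem [Fact p.Prime] [Nonempty ι] {R : Set (Z × (ι → ZMod p))}
    (hR : ∀ o, ∀ a ∈ R, towerAct p ι x y o a ∈ R) {z₀ : Z} (h₀ : (z₀, 0) ∈ R)
    (htrans : ∀ T : Set Z, z₀ ∈ T → (∀ z ∈ T, x z ∈ T) → (∀ z ∈ T, y z ∈ T) → T = Set.univ) :
    R = Set.univ := by
  have hmul : ∀ (i : ι) (k : ℕ) z e, (z, e) ∈ R → (z, Pi.single i (k : ZMod p) + e) ∈ R := by
    intro i k z e h
    induction k with
    | zero => simpa using h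
    | succ k ih =>
      have h1 := hR (some i) _ ih
      simp only [towerAct, letterShift, ← add_assoc, ← Pi.single_add] at h1
      rwa [Nat.cast_succ, add_comm (k : ZMod p)]
  have hadd : ∀ (s : Finset ι) (e' : ι → ZMod p) z e, (z, e) ∈ R →
      (z, ∑ i ∈ s, Pi.single i (e' i) + e) ∈ R := by
    intro s e' z e h
    induction s using Finset.induction_on with
    | empty => simpa using h
    | insert i s his ih =>
      rw [Finset.sum_insert his, add_assoc, ← ZMod.natCast_zmod_val (e' i)]
      exact hmul i _ _ _ ih
  have hmove : ∀ {z e} e', (z, e) ∈ R → (z, e') ∈ R := by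
    intro z e e' h
    have h1 := hadd Finset.univ (e' - e) z e h
    rwa [Finset.univ_sum_single, sub_add_cancel] at h1
  have h := htrans {z | (z, 0) ∈ R} h₀ (fun z hz => ?_) fun z hz => ?_
  · refine Set.eq_univ_of_forall fun a => ?_
    have : a.1 ∈ {z | (z, 0) ∈ R} := h ▸ Set.mem_univ _
    exact hmove a.2 this
  · simpa [towerAct] using hR none _ hz
  · have h1 := hR none _ (hmove 1 hz)
    simp only [towerAct, one_ne_zero, if_false, if_true] at h1
    exact hmove 0 h1

end Construction

/-! ### Transitivity and generation. -/

/-- Two permutations of order dividing `q` that generate a transitive group on a large set. -/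
theorem exists_transitive_perms {q : ℕ} (hq : 1 < q) (m : ℕ) : ∃ (Z : Type) (_ : Finite Z)
    (x y : Equiv.Perm Z) (z₀ : Z), m ≤ Nat.card Z ∧ x ^ q = 1 ∧ y ^ q = 1 ∧
      ∀ T : Set Z, z₀ ∈ T → (∀ z ∈ T, x z ∈ T) → (∀ z ∈ T, y z ∈ T) → T = Set.univ := by
  have : NeZero q := ⟨by omega⟩
  have : Fact (1 < q) := ⟨hq⟩
  let x : Equiv.Perm (ZMod (m + 1) × ZMod q) := (Equiv.refl _).prodCongr (Equiv.addRight 1)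
  let φ : Equiv.Perm (ZMod (m + 1) × ZMod q) :=
    { toFun := fun a => (if a.2 = 0 then a.1 + 1 else a.1, a.2)
      invFun := fun a => (if a.2 = 0 then a.1 - 1 else a.1, a.2)
      left_inv := fun a => by by_cases h : a.2 = 0 <;> simp [h, Prod.ext_iff]
      right_inv := fun a => by by_cases h : a.2 = 0 <;> simp [h, Prod.ext_iff] }
  have hxk : ∀ (k : ℕ) i j, (x ^ k) (i, j) = (i, j + k) := by
    intro k i j
    induction k with
    | zero => simp
    | succ k ih =>
      rw [pow_succ', Equiv.Perm.mul_apply, ih]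
      simp [x, add_assoc]
  have hxq : x ^ q = 1 := by
    ext a
    · rw [hxk]; simp
    · rw [hxk]; simp
  refine ⟨_, inferInstance, x, φ * x * φ⁻¹, (0, 0), ?_, hxq, ?_, fun T h₀ hx hy => ?_⟩
  · rw [Nat.card_prod, Nat.card_zmod, Nat.card_zmod]
    nlinarith
  · rw [conj_pow, hxq, mul_one, mul_inv_cancel]
  · have hxT : ∀ (k : ℕ) a, a ∈ T → (x ^ k) a ∈ T := by
      intro k a ha
      induction k with
      | zero => simpa using ha
      | succ k ih => rw [pow_succ', Equiv.Perm.mul_apply]; exact hx _ ih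
    -- `x ^ (q - 1)` leads to `(i, -1)`, which `φ⁻¹` fixes since `q > 1`; then `x` returns to layer
    -- `0`, where `φ` advances `i`.
    have hstep : ∀ i : ZMod (m + 1), (i, (0 : ZMod q)) ∈ T → (i + 1, (0 : ZMod q)) ∈ T := by
      intro i hi
      have h1 := hy _ (hxT (q - 1) _ hi)
      have hcast : ((q - 1 : ℕ) : ZMod q) = -1 := by
        rw [Nat.cast_sub hq.le]; simp
      rw [hxk, hcast, zero_add] at h1
      have hinv : φ⁻¹ (i, -1) = (i, -1) := by
        rw [Equiv.Perm.inv_eq_iff_eq]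
        simp [φ]
      rw [Equiv.Perm.mul_apply, Equiv.Perm.mul_apply, hinv] at h1
      simpa [φ, x] using h1
    have hall : ∀ k : ℕ, ((k : ZMod (m + 1)), (0 : ZMod q)) ∈ T := by
      intro k
      induction k with
      | zero => simpa using h₀
      | succ k ih => simpa using hstep _ ih
    refine Set.eq_univ_of_forall fun a => ?_
    have h1 := hxT a.2.val _ (hall a.1.val)
    rw [hxk] at h1
    simpa using h1

/-- Applying `f` acts by `p`, and `d` then replaces the first component by any `p'`, so every letter
can act next. -/
theorem isNGenerated_actAlg {P : Type u} {Q : Type v} [Fintype P] [Nonempty P] (act : P → Q → Q)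
    (q₀ : Q) (htrans : ∀ R : Set Q, q₀ ∈ R → (∀ p, ∀ q ∈ R, act p q ∈ R) → R = Set.univ) :
    IsNGenerated signature (Fintype.card P) (ActAlg act) := by
  classical
  let mk : P → Q → ActAlg act := Prod.mk
  let X : Finset (ActAlg act) := Finset.univ.image fun p => mk p q₀
  refine ⟨X, Finset.card_image_le, ?_⟩
  let C := FirstOrder.Language.Substructure.closure signature (X : Set (ActAlg act))
  have hX : ∀ p, mk p q₀ ∈ C := fun p =>
    FirstOrder.Language.Substructure.subset_closure (Finset.mem_coe.2
      (Finset.mem_image_of_mem (fun p => mk p q₀) (Finset.mem_univ p)))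
  have h := htrans {q | ∀ p, mk p q ∈ C} hX fun p q hq p' => ?_
  · rw [eq_top_iff]
    rintro ⟨p, q⟩ -
    have : q ∈ {q | ∀ p, mk p q ∈ C} := h ▸ Set.mem_univ q
    exact this p
  · have hf : mk p (act p q) ∈ C :=
      C.fun_mem (OpSymbol.f : signature.Functions 1) ![mk p q] (Fin.forall_fin_one.2 (hq p))
    exact C.fun_mem (OpSymbol.d : signature.Functions 2) ![mk p' q, mk p (act p q)]
      (Fin.forall_fin_two.2 ⟨hq p', hf⟩)

end GroupActionAlgebra

open GroupActionAlgebra in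
theorem theorem1p1 {G : Type u} {S : Type v} [Group G] [Finite G] [Finite S]
    [MulAction G S] [FaithfulSMul G S] (hG : ¬ Group.IsNilpotent G) :
    GroupActionAlgebra.IsINFBFin GroupActionAlgebra.signature
      (GroupActionAlgebra.Alg G S) := by
  have : Nontrivial G := by
    by_contra h
    rw [not_nontrivial_iff_subsingleton] at h
    exact hG inferInstance
  obtain ⟨p, q, hp, hq, hlaw⟩ := exists_primes_wordShift_eq_and_countAt_modEq hG
  have := Fact.mk hp
  intro n hn
  have : Nonempty (Fin n) := ⟨⟨0, hn⟩⟩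
  refine ⟨Fintype.card (Option (Fin n)), Fintype.card_pos, fun m => ?_⟩
  obtain ⟨Z, _, x, y, z₀, hcard, hx, hy, htrans⟩ := exists_transitive_perms hq.one_lt m
  have hfin : Finite (ActAlg (towerAct p (Fin n) x y)) :=
    inferInstanceAs (Finite (Option (Fin n) × Z × (Fin n → ZMod p)))
  refine ⟨ActAlg (towerAct p (Fin n) x y), inferInstance,
    hfin, ?_, isNGenerated_actAlg _ (z₀, 0) fun R h₀ hR => eq_univ_of_towerAct_mem hR h₀ htrans, ?_⟩
  · refine hcard.trans (Nat.card_le_card_of_injective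
      (fun z => ((none, z, 0) : Option (Fin n) × Z × (Fin n → ZMod p))) fun z z' h => ?_)
    exact (Prod.mk.inj (Prod.mk.inj h).2).1
  · intro s t hst b
    obtain ⟨hleft, hright, hword⟩ := termData_of_satisfies hst
    let σ : Fin n → Option (Fin n) := fun i => (b i).1
    -- The `n` variables cannot take all `n + 1` letters as first components.
    obtain ⟨o, ho⟩ : ∃ o, ∀ i, σ i ≠ o := by
      by_contra! h
      simpa using Fintype.card_le_of_surjective σ h
    obtain ⟨hshift, hcount⟩ := hlaw n _ _ hword σ
    have hnot : ∀ l : List (Fin n), o ∉ l.map σ := fun l h => by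
      obtain ⟨i, -, hi⟩ := List.mem_map.1 h
      exact ho i hi
    have hact := foldr_towerAct_congr hx hy (hnot _) (hnot _) hshift hcount (b (termData t).2.2).2
    rw [List.foldr_map, List.foldr_map] at hact
    rw [realize_actAlg, realize_actAlg, hleft, hright]
    exact Prod.ext rfl hact
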